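/- Let $K\subset\mathbb C$ be a field, $f=(f_1,\dots,f_N)\in K[x_1,\dots,x_n]^N$, and let $\xi\in\mathbb C^n$ be an isolated root of $f$. Let $I=\langle f_1,\dots,f_N\rangle\subset\mathbb C[x]$, let $Q$ be the primary component of $I$ at $\xi$ (so $\sqrt Q=\mathfrak m_\xi$), let $\partial^\beta_\xi(p)=(\partial^\beta p)(\xi)$, and let $\mathscr D=I^\perp\cap\mathbb C[\partial_\xi]$ be the space of all finite combinations $\Lambda$ of the $\partial_\xi^\beta$ that vanish on $I$. Write $\mathscr D_t$ for the elements of $\mathscr D$ of order at most $t$, and $o$ for the least $t$ with $\mathscr D_{t+1}=\mathscr D_t$. Let $B=\{(x-\xi)^{\alpha_0},\dots,(x-\xi)^{\alpha_{\delta-1}}\}$ be a basis of $\mathbb C[x]/Q$ with exponent set $E=\{\alpha_0,\dots,\alpha_{\delta-1}\}$, where $\alpha_0=0$ and $B$ is connected to $1$ (every nonzero $\alpha_k$ equals $\alpha_j+e_i$ for some $j$ and $i$). Suppose that $\mathscr D$ has a basis $\Lambda_0,\dots,\Lambda_{\delta-1}$ dual to $B$, i.e. $\Lambda_i((x-\xi)^{\alpha_j})=\delta_{ij}$,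 of the form $$\Lambda_i=\frac1{\alpha_i!}\partial_\xi^{\alpha_i}+\sum_{|\beta|\le|\alpha_i|,\ \beta\notin E}\nu_{\alpha_i,\beta}\,\frac1{\beta!}\partial_\xi^\beta ,$$ with $0=\operatorname{ord}\Lambda_0\le\dots\le\operatorname{ord}\Lambda_{\delta-1}$ and $\mathscr D_t=\operatorname{span}\{\Lambda_j:\operatorname{ord}\Lambda_j\le t\}$ for $0\le t\le o$. Put $\nu_{\alpha_i,\beta}=0$ for $\beta\notin E$, $|\beta|>|\alpha_i|$. For $1\le j\le n$ let $M_j(\mu)$ be the strictly lower triangular $\delta\times\delta$ matrix (rows and columns indexed by $0,\dots,\delta-1$) whose entry in row $i$ and column $k<i$ is $1$ if $\alpha_i=\alpha_k+e_j$, is $0$ if $\alpha_k+e_j\in E$ and $\alpha_i\ne\alpha_k+e_j$, and is the variable $\mu_{\alpha_i,\alpha_k+e_j}$ if $\alpha_k+e_j\notin E$. Let $\mu$ be the collection of all the variables $\mu_{\alpha_i,\beta}$ that occur in these matrices (occurrences with the same index $(\alpha_i,\beta)$ are the same variable), and let $\nu$ be the collection of the numbers $\nu_{\alpha_i,\beta}$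 with the same indices. For $p\in K[x]$ define the parametric normal form $$\mathcal N_{z,\mu}(p)=\sum_{\gamma\in\mathbb N^n}\frac1{\gamma!}\,(\partial^\gamma p)(z)\,M_1(\mu)^{\gamma_1}\cdots M_n(\mu)^{\gamma_n}\,(1,0,\dots,0)^t\in K[z,\mu]^\delta .$$ Then $(z,\mu)=(\xi,\nu)$ is an isolated root, of multiplicity one, of the polynomial system in $K[z,\mu]$ consisting of the entries of $$\mathcal N_{z,\mu}(f_k)=0\quad(k=1,\dots,N),\qquad M_i(\mu)M_j(\mu)-M_j(\mu)M_i(\mu)=0\quad(i,j=1,\dots,n).$$ -/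

import Mathlib

open MvPolynomial

noncomputable section

/-! ### Multi-indices -/

/-- The ordered monomial `a₁ ^ γ₁ * ⋯ * aₙ ^ γₙ` in a possibly non-commutative monoid. -/
def orderedMonomial {A : Type*} [Monoid A] {n : ℕ} (a : Fin n → A) (γ : Fin n →₀ ℕ) : A :=
  (List.ofFn fun i => a i ^ γ i).prod

/-- The multi-index factorial `γ! = γ₁! ⋯ γₙ!`. -/
def multiFactorial {n : ℕ} (γ : Fin n →₀ ℕ) : ℕ :=
  ∏ i, (γ i).factorial

/-- The differential operator `∂^γ = ∂₁ ^ γ₁ ⋯ ∂ₙ ^ γₙ` on `K[x₁, …, xₙ]`. -/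
def mixedPartial {K : Type*} [Field K] {n : ℕ} (γ : Fin n →₀ ℕ) :
    Module.End K (MvPolynomial (Fin n) K) :=
  orderedMonomial
    (fun i => ((pderiv i : Derivation K _ _) : Module.End K (MvPolynomial (Fin n) K))) γ

/-! ### Roots, primary components, multiplicities -/

/-- `x ∈ ℂ^σ` is an isolated root of the system `F` with coefficients in `K ⊆ ℂ`: it is a root, and
the only one in some neighbourhood. -/
def IsIsolatedRoot {K : Type*} [Field K] [Algebra K ℂ] {σ ι : Type*}
    (F : ι → MvPolynomial σ K) (x : σ → ℂ) : Prop :=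
  (∀ k, aeval x (F k) = 0) ∧ ∀ᶠ y in nhds x, (∀ k, aeval y (F k) = 0) → y = x

/-- The ideal of `ℂ[x]` generated by a system with coefficients in `K ⊆ ℂ`. -/
def systemIdeal {K : Type*} [Field K] [Algebra K ℂ] {σ ι : Type*}
    (F : ι → MvPolynomial σ K) : Ideal (MvPolynomial σ ℂ) :=
  Ideal.span (Set.range fun k => MvPolynomial.map (algebraMap K ℂ) (F k))

/-- The component of `I` at the point `x`: the contraction to `ℂ[x]` of the extension of `I` to the
local ring at `x`. When `x` is an isolated point of the zero set of `I`, this is the primary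
component of `I` whose radical is the maximal ideal of `x`. -/
def primaryComponentAt {σ : Type*} (I : Ideal (MvPolynomial σ ℂ)) (x : σ → ℂ) :
    Ideal (MvPolynomial σ ℂ) where
  carrier := {q | ∃ p, eval x p ≠ 0 ∧ p * q ∈ I}
  zero_mem' := ⟨1, by simp, by simp⟩
  add_mem' := by
    rintro a b ⟨p, hp, hpa⟩ ⟨q, hq, hqb⟩
    refine ⟨p * q, by simp [hp, hq], ?_⟩
    have h : p * q * (a + b) = q * (p * a) + p * (q * b) := by ring
    rw [h]
    exact I.add_mem (I.mul_mem_left _ hpa) (I.mul_mem_left _ hqb)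
  smul_mem' := by
    rintro c a ⟨p, hp, hpa⟩
    refine ⟨p, hp, ?_⟩
    have h : p * (c • a) = c * (p * a) := by simp only [smul_eq_mul]; ring
    rw [h]
    exact I.mul_mem_left _ hpa

/-- The multiplicity of the point `x` as a root of the ideal `I`: the dimension of `ℂ[x] / Q`, with
`Q` the component of `I` at `x` (and `0` if this dimension is infinite). -/
def multiplicityAt {σ : Type*} (I : Ideal (MvPolynomial σ ℂ)) (x : σ → ℂ) : ℕ :=
  Module.finrank ℂ (MvPolynomial σ ℂ ⧸ primaryComponentAt I x)

/-! ### Differential functionals at a point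

An element `Λ = ∑ c_β ∂^β` of `ℂ[∂_ξ]` is represented by the polynomial with coefficients `c_β`.
Its order is its total degree. -/

/-- The value `Λ(p) = ∑ c_β (∂^β p)(ξ)`. -/
def applyAt {n : ℕ} (ξ : Fin n → ℂ) (Λ p : MvPolynomial (Fin n) ℂ) : ℂ :=
  ∑ β ∈ Λ.support, coeff β Λ * eval ξ (mixedPartial β p)

theorem applyAt_eq_sum {n : ℕ} (ξ : Fin n → ℂ) (Λ p : MvPolynomial (Fin n) ℂ)
    (s : Finset (Fin n →₀ ℕ)) (hs : Λ.support ⊆ s) :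
    applyAt ξ Λ p = ∑ β ∈ s, coeff β Λ * eval ξ (mixedPartial β p) :=
  Finset.sum_subset hs fun β _ hβ => by rw [notMem_support_iff.mp hβ, zero_mul]

/-- The space `𝒟 = I^⊥ ∩ ℂ[∂_ξ]`. -/
def inverseSystem {n : ℕ} (I : Ideal (MvPolynomial (Fin n) ℂ)) (ξ : Fin n → ℂ) :
    Submodule ℂ (MvPolynomial (Fin n) ℂ) where
  carrier := {Λ | ∀ p ∈ I, applyAt ξ Λ p = 0}
  zero_mem' := by
    intro p _
    simp [applyAt]
  add_mem' := by
    intro a b ha hb p hp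
    classical
    have h : applyAt ξ (a + b) p = applyAt ξ a p + applyAt ξ b p := by
      rw [applyAt_eq_sum ξ (a + b) p _ support_add,
        applyAt_eq_sum ξ a p _ Finset.subset_union_left,
        applyAt_eq_sum ξ b p _ Finset.subset_union_right, ← Finset.sum_add_distrib]
      simp only [coeff_add, add_mul]
    rw [h, ha p hp, hb p hp, add_zero]
  smul_mem' := by
    intro c a ha p hp
    have h : applyAt ξ (c • a) p = c * applyAt ξ a p := by
      rw [applyAt_eq_sum ξ (c • a) p _ support_smul, applyAt, Finset.mul_sum]
      simp only [coeff_smul, smul_eq_mul, mul_assoc]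
    rw [h, ha p hp, mul_zero]

/-- The space `𝒟_t` of the elements of `𝒟` of order at most `t`. -/
def inverseSystemLE {n : ℕ} (I : Ideal (MvPolynomial (Fin n) ℂ)) (ξ : Fin n → ℂ) (t : ℕ) :
    Submodule ℂ (MvPolynomial (Fin n) ℂ) :=
  inverseSystem I ξ ⊓ restrictTotalDegree (Fin n) ℂ t

/-- The nil-index of `𝒟`: the smallest `t` with `𝒟_{t+1} = 𝒟_t`. -/
def nilIndex {n : ℕ} (I : Ideal (MvPolynomial (Fin n) ℂ)) (ξ : Fin n → ℂ) : ℕ :=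
  sInf {t | inverseSystemLE I ξ (t + 1) = inverseSystemLE I ξ t}

/-- The shifted monomial `(x - ξ)^γ`. -/
def shiftedMonomial {n : ℕ} (ξ : Fin n → ℂ) (γ : Fin n →₀ ℕ) : MvPolynomial (Fin n) ℂ :=
  ∏ i, (X i - C (ξ i)) ^ γ i

/-- The exponents `α₀, …, α_{δ-1}` and the functionals `Λ₀, …, Λ_{δ-1}` form an orthogonal
primal-dual basis pair of the local ring `ℂ[x] / Q` of `I` at `ξ`. -/
structure IsOrthogonalPrimalDualPair {n δ : ℕ} [NeZero δ] (I : Ideal (MvPolynomial (Fin n) ℂ))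
    (ξ : Fin n → ℂ) (α : Fin δ → Fin n →₀ ℕ) (Λ : Fin δ → MvPolynomial (Fin n) ℂ) : Prop where
  /-- The `(x - ξ)^{α_i}` are linearly independent modulo `Q`. -/
  primal_linearIndependent : LinearIndependent ℂ fun i =>
    Ideal.Quotient.mk (primaryComponentAt I ξ) (shiftedMonomial ξ (α i))
  /-- The `(x - ξ)^{α_i}` span `ℂ[x] / Q`. -/
  primal_span : Submodule.span ℂ (Set.range fun i =>
    Ideal.Quotient.mk (primaryComponentAt I ξ) (shiftedMonomial ξ (α i))) = ⊤
  exponent_zero : α 0 = 0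
  /-- The primal basis is connected to `1`. -/
  connected : ∀ k, α k ≠ 0 → ∃ j i, α k = α j + Finsupp.single i 1
  dual_linearIndependent : LinearIndependent ℂ Λ
  dual_span : Submodule.span ℂ (Set.range Λ) = inverseSystem I ξ
  orthogonal : ∀ i j, applyAt ξ (Λ i) (shiftedMonomial ξ (α j)) = if i = j then 1 else 0
  /-- `Λ_i` is `∂^{α_i} / α_i!` plus terms in `∂^β` with `|β| ≤ |α_i|` and `β ∉ E`. -/
  dual_coeff_self : ∀ i, coeff (α i) (Λ i) = (multiFactorial (α i) : ℂ)⁻¹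
  dual_coeff_other : ∀ i β, coeff β (Λ i) ≠ 0 → β ≠ α i →
    β.degree ≤ (α i).degree ∧ β ∉ Set.range α
  order_zero : (Λ 0).totalDegree = 0
  order_monotone : Monotone fun i => (Λ i).totalDegree
  order_span : ∀ t ≤ nilIndex I ξ,
    inverseSystemLE I ξ t = Submodule.span ℂ (Λ '' {j | (Λ j).totalDegree ≤ t})

/-- The coefficients `ν_{α_i, β}` of the dual basis, in `Λ_i = ∑ ν_{α_i, β} ∂^β / β!`. -/
def dualCoeff {n δ : ℕ} (Λ : Fin δ → MvPolynomial (Fin n) ℂ) (i : Fin δ) (β : Fin n →₀ ℕ) : ℂ :=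
  multiFactorial β * coeff β (Λ i)

/-! ### Parametric multiplication matrices and normal form -/

/-- The indices `(α_i, β)` of the parameters `μ_{α_i, β}`: those with `β = α_k + e_j ∉ E` for some
`k < i` and some `j`, that is, those which occur in the strictly triangular matrices below. -/
def ParamIndex {n δ : ℕ} (α : Fin δ → Fin n →₀ ℕ) : Type :=
  {p : Fin δ × (Fin n →₀ ℕ) //
    p.2 ∉ Set.range α ∧ ∃ k < p.1, ∃ j, p.2 = α k + Finsupp.single j 1}

instance {n δ : ℕ} (α : Fin δ → Fin n →₀ ℕ) : Finite (ParamIndex α) := by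
  refine Finite.of_injective (β := Fin δ × Set.range fun q : Fin δ × Fin n =>
      α q.1 + Finsupp.single q.2 1)
    (fun p => (p.1.1, ⟨p.1.2, by
      obtain ⟨_, k, _, j, hj⟩ := p.2
      exact ⟨(k, j), hj.symm⟩⟩)) ?_
  intro p q h
  simp only [Prod.mk.injEq, Subtype.mk.injEq] at h
  exact Subtype.ext (Prod.ext h.1 h.2)

/-- The ring `K[z, μ]`. -/
abbrev ParamRing (K : Type*) [Field K] {n δ : ℕ} (α : Fin δ → Fin n →₀ ℕ) : Type _ :=
  MvPolynomial (Fin n ⊕ ParamIndex α) K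

open Classical in
/-- The parametric multiplication matrix `M_j(μ)`. It is strictly lower triangular; its entry in
row `i` and column `k < i` is `μ_{α_i, α_k + e_j}`, which is a variable if `α_k + e_j ∉ E`, and
otherwise `1` or `0` according to whether `α_i = α_k + e_j`. -/
def paramMatrix (K : Type*) [Field K] {n δ : ℕ} (α : Fin δ → Fin n →₀ ℕ) (j : Fin n) :
    Matrix (Fin δ) (Fin δ) (ParamRing K α) :=
  Matrix.of fun i k =>
    if hki : k < i then
      if hE : α k + Finsupp.single j 1 ∈ Set.range α then
        if α i = α k + Finsupp.single j 1 then 1 else 0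
      else X (Sum.inr ⟨(i, α k + Finsupp.single j 1), hE, k, hki, j, rfl⟩)
    else 0

/-- The parametric normal form `∑_γ (1 / γ!) ∂^γ(p)(z) M(μ)^γ [1]`, with
`M(μ)^γ = M₁(μ)^{γ₁} ⋯ Mₙ(μ)^{γₙ}` and `[1] = (1, 0, …, 0)`. -/
def paramNormalForm {K : Type*} [Field K] {n δ : ℕ} [NeZero δ] (α : Fin δ → Fin n →₀ ℕ)
    (p : MvPolynomial (Fin n) K) : Fin δ → ParamRing K α :=
  ∑ᶠ γ : Fin n →₀ ℕ,
    (C ((multiFactorial γ : K)⁻¹) * rename Sum.inl (mixedPartial γ p) : ParamRing K α) •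
      (orderedMonomial (paramMatrix K α) γ).mulVec (Pi.single 0 1)

/-- `∂^γ` lowers degrees by `|γ|`. -/
theorem mixedPartial_degree_lt {K : Type*} [Field K] {n : ℕ} (γ : Fin n →₀ ℕ) (d : ℕ)
    (p : MvPolynomial (Fin n) K) (hp : p ∈ restrictSupport K {s : Fin n →₀ ℕ | s.degree < d}) :
    mixedPartial γ p ∈ restrictSupport K {s : Fin n →₀ ℕ | s.degree < d - γ.degree} := by
  have h1 : ∀ (i : Fin n) (d : ℕ) (p : MvPolynomial (Fin n) K),
      p ∈ restrictSupport K {s : Fin n →₀ ℕ | s.degree < d} →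
      pderiv i p ∈ restrictSupport K {s : Fin n →₀ ℕ | s.degree < d - 1} := by
    intro i d p hp
    rw [p.as_sum, map_sum]
    refine Submodule.sum_mem _ fun s hs => ?_
    have hs' : s.degree < d := ((mem_restrictSupport_iff K).mp hp) hs
    rw [pderiv_monomial]
    by_cases h0 : s i = 0
    · simp [h0]
    · refine (mem_restrictSupport_iff K).mpr fun t ht => ?_
      have : t = s - Finsupp.single i 1 := by
        simpa using support_monomial_subset ht
      subst this
      have hle : Finsupp.single i 1 ≤ s := by
        simpa [Finsupp.single_le_iff] using Nat.one_le_iff_ne_zero.mpr h0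
      have := congrArg Finsupp.degree (tsub_add_cancel_of_le hle)
      simp only [map_add, Finsupp.degree_single] at this
      simp only [Set.mem_ofPred_eq]
      omega
  have h2 : ∀ (i : Fin n) (k d : ℕ) (p : MvPolynomial (Fin n) K),
      p ∈ restrictSupport K {s : Fin n →₀ ℕ | s.degree < d} →
      ((((pderiv i : Derivation K _ _) : Module.End K (MvPolynomial (Fin n) K))) ^ k) p ∈
        restrictSupport K {s : Fin n →₀ ℕ | s.degree < d - k} := by
    intro i k
    induction k with
    | zero => intro d p hp; simpa using hp
    | succ k ih =>
      intro d p hp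
      rw [pow_succ, Module.End.mul_apply]
      have := ih _ _ (h1 i d p hp)
      rwa [Nat.sub_sub, Nat.add_comm 1 k] at this
  have h3 : ∀ (l : List (Fin n)) (d : ℕ),
      (l.map fun i => (((pderiv i : Derivation K _ _) :
        Module.End K (MvPolynomial (Fin n) K))) ^ γ i).prod p ∈
        restrictSupport K {s : Fin n →₀ ℕ | s.degree < d - (l.map γ).sum} ∨
      p ∉ restrictSupport K {s : Fin n →₀ ℕ | s.degree < d} := by
    intro l d
    by_cases hp : p ∈ restrictSupport K {s : Fin n →₀ ℕ | s.degree < d}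
    · left
      induction l with
      | nil => simpa using hp
      | cons i l ih =>
        have := h2 i (γ i) _ _ ih
        rw [Nat.sub_sub, Nat.add_comm] at this
        simp only [List.map_cons, List.sum_cons]
        exact this
    · exact Or.inr hp
  have h4 := (h3 (List.finRange n) d).resolve_right (not_not.mpr hp)
  rw [← List.ofFn_eq_map, ← List.ofFn_eq_map, List.sum_ofFn, ← Finsupp.degree_eq_sum] at h4
  exact h4

/-- Only finitely many `∂^γ(p)` are nonzero, so the sum in `paramNormalForm` is finite. -/
theorem finite_mixedPartial_ne_zero {K : Type*} [Field K] {n : ℕ} (p : MvPolynomial (Fin n) K) :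
    {γ : Fin n →₀ ℕ | mixedPartial γ p ≠ 0}.Finite := by
  refine (Finsupp.finite_of_degree_le (σ := Fin n) p.totalDegree).subset fun γ hγ => ?_
  by_contra hlt
  simp only [Set.mem_ofPred_eq, not_le] at hlt
  refine hγ ?_
  have h := mixedPartial_degree_lt γ (p.totalDegree + 1) p
    ((mem_restrictSupport_iff K).mpr fun s hs => Nat.lt_succ_of_le ((Finsupp.degree_eq_sum s).trans_le
      (by simpa [Finsupp.sum_fintype] using le_totalDegree hs)))
  rw [show p.totalDegree + 1 - γ.degree = 0 by omega] at h
  refine support_eq_empty.mp (Finset.eq_empty_of_forall_notMem fun s hs => ?_)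
  exact absurd ((mem_restrictSupport_iff K).mp h hs) (by simp)

/-- The equations of the deflated system: the entries of the parametric normal forms of the `f_k`
and the entries of the commutators of the parametric multiplication matrices. -/
def deflatedSystem {K : Type*} [Field K] {n N δ : ℕ} [NeZero δ] (α : Fin δ → Fin n →₀ ℕ)
    (f : Fin N → MvPolynomial (Fin n) K) :
    (Fin N × Fin δ) ⊕ ((Fin n × Fin n) × (Fin δ × Fin δ)) → ParamRing K α
  | Sum.inl (k, a) => paramNormalForm α (f k) a
  | Sum.inr ((i, j), (a, b)) =>
      (paramMatrix K α i * paramMatrix K α j - paramMatrix K α j * paramMatrix K α i) a b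

/-- The point `(ξ, ν)` with `ν` the coefficients of the dual basis `Λ`. -/
def deflatedPoint {n δ : ℕ} (ξ : Fin n → ℂ) (α : Fin δ → Fin n →₀ ℕ)
    (Λ : Fin δ → MvPolynomial (Fin n) ℂ) : Fin n ⊕ ParamIndex α → ℂ :=
  Sum.elim ξ fun p => dualCoeff Λ p.1.1 p.1.2

end

noncomputable section

/-! ### The Taylor formula for polynomials -/

/-! Everything rests on a rigidity statement, `eq_deflatedPoint`: over any commutative ℂ-algebra R,
a solution (z, μ) of the deflated system with all z_j - ξ_j nilpotent must be (ξ, ν).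

The commutator equations make x_j ↦ z_j + M_j(μ) an algebra homomorphism φ, and by the Taylor
formula the normal form of p is φ(p)e₀. Connectedness to 1 makes e₀ cyclic for the M_j, so φ(f_k)e₀
= 0 gives φ(f_k) = 0. Since z_j - ξ_j and M_j are nilpotent, φ also kills Q, and q ↦ φ(q)e₀ induces
an R-linear map P from (ℂ[x]/Q) ⊗ R to R^δ. Its image contains e₀ and is stable under the M_j, so P
is surjective, and invertible because it is square. It conjugates multiplication by x_j - ξ_j, of
trace 0, to (z_j - ξ_j) + M_j, of trace δ(z_j - ξ_j). Hence z = ξ, then P = 1, and the M_j are the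
multiplication matrices of the local ring, whose entries are the ν.

With R = ℂ this gives isolatedness, because the z-part of a root of the deflated system is a root of
f. With R = ℂ[z, μ]/(I' + 𝔪²), where I' is the deflated ideal and 𝔪 the maximal ideal of (ξ, ν), it
gives 𝔪 ⊆ I' + 𝔪², and Nakayama's lemma yields multiplicity one. -/

theorem pderiv_pow_apply_monomial {K : Type*} [Field K] {n : ℕ} (i : Fin n) (k : ℕ)
    (s : Fin n →₀ ℕ) (c : K) :
    (((pderiv i : Derivation K _ _) : Module.End K (MvPolynomial (Fin n) K)) ^ k) (monomial s c) =
      monomial (s - Finsupp.single i k) (c * ((s i).descFactorial k : K)) := by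
  induction k with
  | zero => simp
  | succ k ih =>
    rw [pow_succ', Module.End.mul_apply, ih]
    change pderiv i _ = _
    rw [pderiv_monomial, tsub_tsub, ← Finsupp.single_add, Nat.descFactorial_succ]
    congr 1
    simp only [Finsupp.coe_tsub, Pi.sub_apply, Finsupp.single_eq_same, Nat.cast_mul]
    ring

/-- Truncated subtraction in the exponent is harmless: if γ i > s i for some i, the factor
`descFactorial` is zero. -/
theorem mixedPartial_monomial {K : Type*} [Field K] {n : ℕ} (γ s : Fin n →₀ ℕ) (c : K) :
    mixedPartial γ (monomial s c) =
      monomial (s - γ) (c * ∏ i, ((s i).descFactorial (γ i) : K)) := by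
  have h : ∀ l : List (Fin n), l.Nodup →
      (l.map fun i => (((pderiv i : Derivation K _ _) :
        Module.End K (MvPolynomial (Fin n) K))) ^ γ i).prod (monomial s c) =
      monomial (s - (l.map fun i => Finsupp.single i (γ i)).sum)
        (c * (l.map fun i => ((s i).descFactorial (γ i) : K)).prod) := by
    intro l hl
    induction l with
    | nil => simp
    | cons i l ih =>
      obtain ⟨hi, hl⟩ := List.nodup_cons.mp hl
      -- The entries of the list are distinct, so the derivatives already applied leave the exponent
      -- of x_i unchanged.
      have h0 : (l.map fun j => Finsupp.single j (γ j)).sum i = 0 := by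
        rw [← Finsupp.applyAddHom_apply, map_list_sum, List.map_map]
        refine List.sum_eq_zero fun a ha => ?_
        obtain ⟨j, hj, rfl⟩ := List.mem_map.mp ha
        have : j ≠ i := fun h => hi (h ▸ hj)
        simp [this]
      simp only [List.map_cons, List.prod_cons, List.sum_cons]
      rw [Module.End.mul_apply, ih hl, pderiv_pow_apply_monomial, tsub_tsub, Finsupp.tsub_apply,
        h0, tsub_zero, add_comm]
      congr 1
      ring
  have := h (List.finRange n) (List.nodup_finRange n)
  rw [← List.ofFn_eq_map, ← List.ofFn_eq_map, ← List.ofFn_eq_map, List.sum_ofFn, List.prod_ofFn,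
    Finsupp.univ_sum_single] at this
  exact this

theorem orderedMonomial_eq_prod {S : Type*} [CommMonoid S] {n : ℕ} (a : Fin n → S)
    (γ : Fin n →₀ ℕ) : orderedMonomial a γ = ∏ i, a i ^ γ i :=
  List.prod_ofFn

theorem map_orderedMonomial {A B F : Type*} [Monoid A] [Monoid B] [FunLike F A B]
    [MonoidHomClass F A B] (g : F) {n : ℕ} (a : Fin n → A) (γ : Fin n →₀ ℕ) :
    g (orderedMonomial a γ) = orderedMonomial (fun i => g (a i)) γ := by
  simp only [orderedMonomial, map_list_prod, List.map_ofFn]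
  congr 2
  ext i
  simp

/-- Supplies the finiteness needed to move additive maps through Taylor sums; F is arbitrary so that
scalar, vector and matrix sums are all covered. -/
theorem support_taylor_subset {K M : Type*} [Field K] [AddCommMonoid M] {n : ℕ}
    (p : MvPolynomial (Fin n) K) (F : (Fin n →₀ ℕ) → MvPolynomial (Fin n) K → M)
    (hF : ∀ γ, F γ 0 = 0) : (Function.support fun γ => F γ (mixedPartial γ p)).Finite := by
  refine (finite_mixedPartial_ne_zero p).subset fun γ hγ h0 => hγ ?_
  simp only [h0, hF]

/-- By additivity it suffices to treat a monomial, where the formula is the product over the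
variables of the binomial expansions of (z i + a i) ^ s i. -/
theorem aeval_add_eq_finsum {K S : Type*} [Field K] [CharZero K] [CommRing S] [Algebra K S]
    {n : ℕ} (z a : Fin n → S) (p : MvPolynomial (Fin n) K) :
    aeval (fun i => z i + a i) p =
      ∑ᶠ γ : Fin n →₀ ℕ, (algebraMap K S (multiFactorial γ : K)⁻¹ * aeval z (mixedPartial γ p)) *
        orderedMonomial a γ := by
  induction p using MvPolynomial.induction_on' with
  | add p q hp hq =>
    rw [map_add, hp, hq, ← finsum_add_distrib
      (support_taylor_subset p (fun γ q => (algebraMap K S (multiFactorial γ : K)⁻¹ * aeval z q) *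
        orderedMonomial a γ) (by simp))
      (support_taylor_subset q (fun γ q => (algebraMap K S (multiFactorial γ : K)⁻¹ * aeval z q) *
        orderedMonomial a γ) (by simp))]
    refine finsum_congr fun γ => ?_
    simp only [map_add]
    ring
  | monomial s c =>
    have key : ∀ g : Fin n → ℕ, (algebraMap K S (multiFactorial (Finsupp.equivFunOnFinite.symm g)
          : K)⁻¹ * aeval z (mixedPartial (Finsupp.equivFunOnFinite.symm g) (monomial s c))) *
          orderedMonomial a (Finsupp.equivFunOnFinite.symm g) =
        algebraMap K S c * ∏ i, (a i ^ g i * z i ^ (s i - g i) * ((s i).choose (g i) : S)) := by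
      intro g
      have hc : (multiFactorial (Finsupp.equivFunOnFinite.symm g) : K)⁻¹ *
          (c * ∏ i, ((s i).descFactorial (g i) : K)) = c * ∏ i, ((s i).choose (g i) : K) := by
        have : ∏ i, ((s i).descFactorial (g i) : K) =
            (multiFactorial (Finsupp.equivFunOnFinite.symm g) : K) *
              ∏ i, ((s i).choose (g i) : K) := by
          simp only [multiFactorial, Nat.descFactorial_eq_factorial_mul_choose, Nat.cast_mul,
            Finset.prod_mul_distrib, Nat.cast_prod, Finsupp.equivFunOnFinite_symm_apply_apply]
        have h0 : (multiFactorial (Finsupp.equivFunOnFinite.symm g) : K) ≠ 0 := by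
          simp [multiFactorial, Finset.prod_ne_zero_iff, Nat.factorial_ne_zero]
        rw [this]
        field_simp
      rw [mixedPartial_monomial, aeval_monomial, orderedMonomial_eq_prod, ← mul_assoc, ← map_mul]
      simp only [Finsupp.equivFunOnFinite_symm_apply_apply]
      rw [hc, Finsupp.prod_fintype _ _ (by simp)]
      simp only [map_mul, map_prod, map_natCast, Finset.prod_mul_distrib, Finsupp.tsub_apply,
        Finsupp.equivFunOnFinite_symm_apply_apply]
      ring
    rw [← finsum_comp_equiv Finsupp.equivFunOnFinite.symm, finsum_congr key,
      finsum_eq_sum_of_support_subset (s := Fintype.piFinset fun i => Finset.range (s i + 1)),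
      ← Finset.mul_sum, ← Finset.prod_univ_sum (fun i => Finset.range (s i + 1))
        (fun i k => a i ^ k * z i ^ (s i - k) * ((s i).choose k : S)), aeval_monomial, Finsupp.prod_fintype _ _ (by simp)]
    · refine congrArg _ (Finset.prod_congr rfl fun i _ => ?_)
      rw [add_comm, add_pow]
    · intro g hg
      rw [Finset.mem_coe, Fintype.mem_piFinset]
      intro i
      -- Outside the box g ≤ s some binomial coefficient vanishes.
      by_contra hi
      refine hg ?_
      have : ((s i).choose (g i) : S) = 0 := by
        rw [Nat.choose_eq_zero_of_lt (by simpa using hi), Nat.cast_zero]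
      simp only
      rw [Finset.prod_eq_zero (Finset.mem_univ i) (by rw [this, mul_zero]), mul_zero]

open scoped IsMulCommutative in
/-- Commuting elements `a i` of an algebra and scalars `z i` define an evaluation homomorphism
`x_i ↦ z i + a i`, given by the Taylor formula at `z`. -/
theorem exists_algHom_taylor {K R A : Type*} [Field K] [CharZero K] [CommRing R] [Algebra K R]
    [Ring A] [Algebra R A] {n : ℕ} (z : Fin n → R) (a : Fin n → A)
    (ha : ∀ i j, a i * a j = a j * a i) :
    ∃ φ : MvPolynomial (Fin n) R →ₐ[R] A, (∀ i, φ (X i) = algebraMap R A (z i) + a i) ∧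
      ∀ p : MvPolynomial (Fin n) K, φ (map (algebraMap K R) p) =
        ∑ᶠ γ : Fin n →₀ ℕ,
          (algebraMap K R (multiFactorial γ : K)⁻¹ * aeval z (mixedPartial γ p)) •
            orderedMonomial a γ := by
  have hcomm : ∀ x ∈ Set.range a, ∀ y ∈ Set.range a, x * y = y * x := by
    rintro _ ⟨i, rfl⟩ _ ⟨j, rfl⟩
    exact ha i j
  -- The a i generate a commutative subalgebra, in which the commutative Taylor formula applies.
  let S := Algebra.adjoin R (Set.range a)
  have : IsMulCommutative S := Algebra.isMulCommutative_adjoin R hcomm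
  let b : Fin n → S := fun i => ⟨a i, Algebra.subset_adjoin ⟨i, rfl⟩⟩
  let := Algebra.compHom S (algebraMap K R)
  have : IsScalarTower K R S := IsScalarTower.of_algebraMap_eq' rfl
  refine ⟨S.val.comp (aeval fun i => algebraMap R S (z i) + b i), fun i => by simp [b],
    fun p => ?_⟩
  have hfin : (Function.support fun γ : Fin n →₀ ℕ =>
      (algebraMap K S (multiFactorial γ : K)⁻¹ *
        aeval (fun i => algebraMap R S (z i)) (mixedPartial γ p)) *
        orderedMonomial b γ).Finite :=
    support_taylor_subset p (fun γ q => (algebraMap K S (multiFactorial γ : K)⁻¹ *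
      aeval (fun i => algebraMap R S (z i)) q) * orderedMonomial b γ) (by simp)
  rw [AlgHom.comp_apply, aeval_map_algebraMap, aeval_add_eq_finsum, map_finsum _ hfin]
  refine finsum_congr fun γ => ?_
  rw [show (fun i => algebraMap R S (z i)) = algebraMap R S ∘ z from rfl, aeval_algebraMap_apply,
    IsScalarTower.algebraMap_apply K R S, ← map_mul, map_mul,
    map_orderedMonomial, AlgHom.commutes, ← Algebra.smul_def]
  rfl

/-! ### The local component of an ideal at a point -/

theorem aeval_eq_eval_apply {σ : Type*} (x : σ → ℂ) (p : MvPolynomial σ ℂ) :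
    aeval x p = eval x p := by
  rw [← coe_aeval_eq_eval]
  rfl

/-- The maximal ideal of the point `x`. -/
def pointIdeal {σ : Type*} (x : σ → ℂ) : Ideal (MvPolynomial σ ℂ) :=
  Ideal.span (Set.range fun j => X j - C (x j))

theorem X_sub_C_mem_pointIdeal {σ : Type*} (x : σ → ℂ) (j : σ) : X j - C (x j) ∈ pointIdeal x :=
  Ideal.subset_span ⟨j, rfl⟩

theorem sub_C_eval_mem_pointIdeal {σ : Type*} (x : σ → ℂ) (p : MvPolynomial σ ℂ) :
    p - C (eval x p) ∈ pointIdeal x := by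
  induction p using MvPolynomial.induction_on with
  | C a => simp
  | add p q hp hq =>
    convert! Ideal.add_mem _ hp hq using 1
    simp only [map_add]
    ring
  | mul_X p i hp =>
    convert! Ideal.add_mem _ (Ideal.mul_mem_left _ p (X_sub_C_mem_pointIdeal x i))
      (Ideal.mul_mem_left _ (C (x i)) hp) using 1
    simp only [map_mul, eval_X]
    ring

theorem mem_pointIdeal_iff {σ : Type*} (x : σ → ℂ) (p : MvPolynomial σ ℂ) :
    p ∈ pointIdeal x ↔ eval x p = 0 := by
  refine ⟨fun hp => ?_, fun hp => by simpa [hp] using sub_C_eval_mem_pointIdeal x p⟩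
  have : pointIdeal x ≤ RingHom.ker (eval x) := by
    rw [pointIdeal, Ideal.span_le]
    rintro _ ⟨j, rfl⟩
    simp [RingHom.mem_ker]
  exact this hp

theorem le_primaryComponentAt {σ : Type*} (I : Ideal (MvPolynomial σ ℂ)) (x : σ → ℂ) :
    I ≤ primaryComponentAt I x :=
  fun p hp => ⟨1, by simp, by simpa using hp⟩

/-- If p(x) ≠ 0, then p is a nonzero constant plus an element nilpotent modulo J, hence a unit
modulo J; so pq ∈ J forces q ∈ J. -/
theorem primaryComponentAt_le {σ : Type*} {I J : Ideal (MvPolynomial σ ℂ)} {x : σ → ℂ}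
    (hIJ : I ≤ J) (hJ : pointIdeal x ≤ J.radical) : primaryComponentAt I x ≤ J := by
  rintro q ⟨p, hp, hpq⟩
  have hu : p - C (eval x p) ∈ J.radical := hJ (sub_C_eval_mem_pointIdeal x p)
  rw [← neg_sub, neg_mem_iff] at hu
  obtain ⟨k, hk⟩ := hu
  obtain ⟨s, hs⟩ : p ∣ C (eval x p) ^ k - (C (eval x p) - p) ^ k := by
    have := sub_dvd_pow_sub_pow (C (eval x p)) (C (eval x p) - p) k
    rwa [show C (eval x p) - (C (eval x p) - p) = p by ring] at this
  have h1 : C (eval x p ^ k) * q ∈ J := by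
    have : C (eval x p ^ k) * q = (C (eval x p) - p) ^ k * q + s * (p * q) := by
      rw [map_pow, ← sub_add_cancel (C (eval x p) ^ k) ((C (eval x p) - p) ^ k), hs]
      ring
    rw [this]
    exact J.add_mem (J.mul_mem_right _ hk) (J.mul_mem_left _ (hIJ hpq))
  have h2 := J.mul_mem_left (C (eval x p ^ k)⁻¹) h1
  rwa [← mul_assoc, ← C_mul, inv_mul_cancel₀ (pow_ne_zero _ hp), C_1, one_mul] at h2

/-- A point at which the ideal generates the cotangent space has multiplicity one. -/
theorem multiplicityAt_eq_one {σ : Type*} [Finite σ] {I : Ideal (MvPolynomial σ ℂ)} {x : σ → ℂ}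
    (hI : I ≤ pointIdeal x) (hx : pointIdeal x ≤ I ⊔ pointIdeal x * pointIdeal x) :
    multiplicityAt I x = 1 := by
  have hcomp : primaryComponentAt I x = RingHom.ker (aeval x : MvPolynomial σ ℂ →ₐ[ℂ] ℂ) := by
    ext q
    rw [RingHom.mem_ker, aeval_eq_eval_apply, ← mem_pointIdeal_iff]
    refine ⟨fun hq => primaryComponentAt_le hI Ideal.le_radical hq, fun hq => ?_⟩
    -- Nakayama without localizing: r ≡ 1 modulo the maximal ideal 𝔪 and r𝔪 ⊆ I. Thus r(x) = 1, and
    -- r witnesses that 𝔪 lies in the component.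
    obtain ⟨r, hr, hrm⟩ := Submodule.exists_sub_one_mem_and_smul_le_of_fg_of_le_sup
      (I := pointIdeal x) (N := I) (N' := pointIdeal x) (M := MvPolynomial σ ℂ)
      (Submodule.fg_span (Set.finite_range _)) (by simp) hx
    refine ⟨r, ?_, hrm (Submodule.smul_mem_pointwise_smul _ r _ hq)⟩
    rw [mem_pointIdeal_iff, map_sub, map_one, sub_eq_zero] at hr
    rw [hr]
    exact one_ne_zero
  rw [multiplicityAt, hcomp, LinearEquiv.finrank_eq
    (Ideal.quotientKerAlgEquivOfSurjective (f := (aeval x : MvPolynomial σ ℂ →ₐ[ℂ] ℂ))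
      fun c => ⟨C c, by simp⟩).toLinearEquiv, Module.finrank_self]

/-! ### Differential functionals and translation -/

/-- The translation `p(x) ↦ p(x + ξ)`. -/
def translateTo {n : ℕ} (ξ : Fin n → ℂ) : MvPolynomial (Fin n) ℂ →ₐ[ℂ] MvPolynomial (Fin n) ℂ :=
  aeval fun i => C (ξ i) + X i

theorem multiFactorial_ne_zero {n : ℕ} (γ : Fin n →₀ ℕ) : (multiFactorial γ : ℂ) ≠ 0 := by
  simp [multiFactorial, Finset.prod_ne_zero_iff, Nat.factorial_ne_zero]

theorem orderedMonomial_X {n : ℕ} (γ : Fin n →₀ ℕ) :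
    orderedMonomial (X : Fin n → MvPolynomial (Fin n) ℂ) γ = monomial γ 1 := by
  rw [orderedMonomial_eq_prod, monomial_eq, Finsupp.prod_fintype _ _ (by simp), C_1, one_mul]

/-- The Taylor formula with increment X: the coefficients of p(ξ + X) are the derivatives at ξ
divided by γ!. -/
theorem eval_mixedPartial {n : ℕ} (ξ : Fin n → ℂ) (γ : Fin n →₀ ℕ) (p : MvPolynomial (Fin n) ℂ) :
    eval ξ (mixedPartial γ p) = multiFactorial γ * coeff γ (translateTo ξ p) := by
  have hfin : (Function.support fun γ : Fin n →₀ ℕ =>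
      (algebraMap ℂ (MvPolynomial (Fin n) ℂ) (multiFactorial γ : ℂ)⁻¹ *
        aeval (fun i => C (ξ i)) (mixedPartial γ p)) *
        orderedMonomial (X : Fin n → MvPolynomial (Fin n) ℂ) γ).Finite :=
    support_taylor_subset p (fun γ q => (algebraMap ℂ (MvPolynomial (Fin n) ℂ)
      (multiFactorial γ : ℂ)⁻¹ * aeval (fun i => C (ξ i)) q) * orderedMonomial X γ) (by simp)
  have hC : ∀ q : MvPolynomial (Fin n) ℂ, aeval (fun i => C (ξ i)) q =
      (C (eval ξ q) : MvPolynomial (Fin n) ℂ) := fun q => by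
    have := aeval_algebraMap_apply (MvPolynomial (Fin n) ℂ) ξ q
    rwa [aeval_eq_eval_apply] at this
  rw [translateTo, aeval_add_eq_finsum, ← lcoeff_apply, map_finsum _ hfin,
    finsum_eq_single _ γ]
  · rw [hC, algebraMap_eq, ← C_mul, orderedMonomial_X, C_mul_monomial, lcoeff_apply,
      coeff_monomial, if_pos rfl, mul_one, mul_inv_cancel_left₀ (multiFactorial_ne_zero γ)]
  · intro β hβ
    rw [hC, algebraMap_eq, ← C_mul, orderedMonomial_X, C_mul_monomial, lcoeff_apply,
      coeff_monomial, if_neg hβ]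

theorem applyAt_eq_sum_coeff {n : ℕ} (ξ : Fin n → ℂ) (Λ p : MvPolynomial (Fin n) ℂ) :
    applyAt ξ Λ p =
      ∑ β ∈ Λ.support, coeff β Λ * (multiFactorial β * coeff β (translateTo ξ p)) :=
  Finset.sum_congr rfl fun β _ => by rw [eval_mixedPartial]

/-- The pairing with a fixed functional, as a linear map. -/
def applyAtLinear {n : ℕ} (ξ : Fin n → ℂ) (Λ : MvPolynomial (Fin n) ℂ) :
    MvPolynomial (Fin n) ℂ →ₗ[ℂ] ℂ where
  toFun := applyAt ξ Λ
  map_add' p q := by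
    simp only [applyAt, map_add, mul_add, Finset.sum_add_distrib]
  map_smul' c p := by
    simp only [applyAt, map_smul, smul_eval, Finset.mul_sum, RingHom.id_apply, smul_eq_mul]
    exact Finset.sum_congr rfl fun β _ => by ring

theorem applyAtLinear_apply {n : ℕ} (ξ : Fin n → ℂ) (Λ p : MvPolynomial (Fin n) ℂ) :
    applyAtLinear ξ Λ p = applyAt ξ Λ p := rfl

theorem translateTo_shiftedMonomial {n : ℕ} (ξ : Fin n → ℂ) (γ : Fin n →₀ ℕ) :
    translateTo ξ (shiftedMonomial ξ γ) = monomial γ 1 := by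
  rw [← orderedMonomial_X, orderedMonomial_eq_prod, shiftedMonomial, map_prod]
  refine Finset.prod_congr rfl fun i _ => ?_
  rw [map_pow, map_sub, translateTo, aeval_X, aeval_C, algebraMap_eq, add_sub_cancel_left]

/-- Identifies ν_{α_i, β} with the value of Λ_i on (x - ξ)^β, so that the parameters become entries
of multiplication matrices. -/
theorem applyAt_shiftedMonomial {n : ℕ} (ξ : Fin n → ℂ) (Λ : MvPolynomial (Fin n) ℂ)
    (γ : Fin n →₀ ℕ) :
    applyAt ξ Λ (shiftedMonomial ξ γ) = multiFactorial γ * coeff γ Λ := by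
  classical
  rw [applyAt_eq_sum_coeff, translateTo_shiftedMonomial, Finset.sum_eq_single γ]
  · rw [coeff_monomial, if_pos rfl]
    ring
  · intro β _ hβ
    rw [coeff_monomial, if_neg hβ.symm]
    ring
  · intro h
    rw [notMem_support_iff.mp h]
    ring

/-- After translation to the origin, p has no term of degree at most the order of Λ. -/
theorem applyAt_eq_zero_of_mem_pow {n : ℕ} (ξ : Fin n → ℂ) (Λ p : MvPolynomial (Fin n) ℂ)
    (hp : p ∈ pointIdeal ξ ^ (Λ.totalDegree + 1)) : applyAt ξ Λ p = 0 := by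
  have hmap : (pointIdeal ξ).map (translateTo ξ) ≤ idealOfVars (Fin n) ℂ := by
    rw [pointIdeal, Ideal.map_span, Ideal.span_le]
    rintro _ ⟨_, ⟨j, rfl⟩, rfl⟩
    rw [map_sub, translateTo, aeval_X, aeval_C, algebraMap_eq, add_sub_cancel_left]
    exact Ideal.subset_span ⟨j, rfl⟩
  have hq : translateTo ξ p ∈ idealOfVars (Fin n) ℂ ^ (Λ.totalDegree + 1) := by
    have := Ideal.mem_map_of_mem (translateTo ξ) hp
    rw [Ideal.map_pow] at this
    exact Ideal.pow_right_mono hmap _ this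
  rw [mem_pow_idealOfVars_iff] at hq
  rw [applyAt_eq_sum_coeff]
  refine Finset.sum_eq_zero fun β hβ => ?_
  have h0 : coeff β (translateTo ξ p) = 0 := by
    by_contra h
    have h1 := hq β (mem_support_iff.mpr h)
    have h2 := le_totalDegree hβ
    rw [Finsupp.degree_eq_sum] at h1
    rw [Finsupp.sum_fintype _ _ (by simp)] at h2
    omega
  rw [h0, mul_zero, mul_zero]

/-- The functionals of the inverse system vanish on the local component of the ideal. -/
theorem applyAt_eq_zero_of_mem_primaryComponentAt {n : ℕ} {I : Ideal (MvPolynomial (Fin n) ℂ)}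
    {ξ : Fin n → ℂ} {Λ q : MvPolynomial (Fin n) ℂ} (hΛ : Λ ∈ inverseSystem I ξ)
    (hq : q ∈ primaryComponentAt I ξ) : applyAt ξ Λ q = 0 := by
  -- The sum of I and a power of the maximal ideal has radical containing that maximal ideal, so it
  -- contains the component. The exponent is the first one for which Λ vanishes on the power.
  have hle : primaryComponentAt I ξ ≤ I ⊔ pointIdeal ξ ^ (Λ.totalDegree + 1) := by
    refine primaryComponentAt_le le_sup_left fun p hp => ⟨Λ.totalDegree + 1, ?_⟩
    exact Ideal.mem_sup_right (Ideal.pow_mem_pow hp _)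
  obtain ⟨a, ha, b, hb, rfl⟩ := Submodule.mem_sup.mp (hle hq)
  rw [← applyAtLinear_apply, map_add, applyAtLinear_apply, applyAtLinear_apply, hΛ a ha,
    applyAt_eq_zero_of_mem_pow ξ Λ b hb, add_zero]

/-! ### Strictly lower triangular matrices -/

/-- The characteristic polynomial of the transpose is X^δ; apply Cayley–Hamilton. -/
theorem isNilpotent_of_strictlyLower {R : Type*} [CommRing R] {δ : ℕ}
    (M : Matrix (Fin δ) (Fin δ) R) (hM : ∀ i k, i ≤ k → M i k = 0) : IsNilpotent M := by
  rw [← Matrix.isNilpotent_transpose_iff]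
  refine ⟨δ, ?_⟩
  have h := Matrix.aeval_self_charpoly M.transpose
  rw [Matrix.charpoly_of_isUpperTriangular M.transpose fun i j (hij : j < i) => hM j i hij.le] at h
  simpa [hM] using h

/-! ### Specializations of the parametric multiplication matrices -/

/-- The combinatorial properties of the exponents of a primal basis. -/
structure IsConnectedExponents {n δ : ℕ} [NeZero δ] (α : Fin δ → Fin n →₀ ℕ) : Prop where
  injective : Function.Injective α
  zero : α 0 = 0
  connected : ∀ k, α k ≠ 0 → ∃ j i, α k = α j + Finsupp.single i 1
  monotone : Monotone fun i => (α i).degree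

namespace IsConnectedExponents

variable {n δ : ℕ} [NeZero δ] {α : Fin δ → Fin n →₀ ℕ}

theorem induction (hα : IsConnectedExponents α) {P : Fin δ → Prop} (h0 : P 0)
    (hs : ∀ j k i, α k = α j + Finsupp.single i 1 → P j → P k) (k : Fin δ) : P k := by
  induction hd : (α k).degree using Nat.strong_induction_on generalizing k with
  | _ d ih =>
    by_cases hk : α k = 0
    · rwa [hα.injective (hk.trans hα.zero.symm)]
    · obtain ⟨j, i, hj⟩ := hα.connected k hk
      refine hs j k i hj (ih _ ?_ j rfl)
      rw [← hd, hj, map_add, Finsupp.degree_single]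
      exact Nat.lt_succ_self _

/-- Guarantees that the entries 1 of the parametric matrices lie strictly below the diagonal, where
they are not cut off. -/
theorem lt_of_eq_add (hα : IsConnectedExponents α) {j k : Fin δ} {i : Fin n}
    (h : α k = α j + Finsupp.single i 1) : j < k := by
  by_contra hkj
  have := hα.monotone (not_lt.mp hkj)
  simp only [h, map_add, Finsupp.degree_single] at this
  omega

end IsConnectedExponents

section Specialization

variable {K R : Type*} [Field K] [CommRing R] [Algebra K R] {n δ : ℕ}
  {α : Fin δ → Fin n →₀ ℕ}

/-- The value of the matrix `M_j(μ)` at a point of `R`. -/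
def specMatrix (K : Type*) [Field K] [Algebra K R] (w : Fin n ⊕ ParamIndex α → R) (j : Fin n) :
    Matrix (Fin δ) (Fin δ) R :=
  (paramMatrix K α j).map (aeval w)

theorem specMatrix_of_le (w : Fin n ⊕ ParamIndex α → R) (j : Fin n) (i k : Fin δ) (h : i ≤ k) :
    specMatrix K w j i k = 0 := by
  simp [specMatrix, paramMatrix, not_lt.mpr h]

theorem isNilpotent_specMatrix (w : Fin n ⊕ ParamIndex α → R) (j : Fin n) :
    IsNilpotent (specMatrix K w j) :=
  isNilpotent_of_strictlyLower _ (specMatrix_of_le w j)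

theorem trace_specMatrix (w : Fin n ⊕ ParamIndex α → R) (j : Fin n) :
    (specMatrix K w j).trace = 0 :=
  Finset.sum_eq_zero fun i _ => specMatrix_of_le w j i i le_rfl

theorem specMatrix_param (w : Fin n ⊕ ParamIndex α → R) (j : Fin n) {i k : Fin δ} (hki : k < i)
    (hE : α k + Finsupp.single j 1 ∉ Set.range α) :
    specMatrix K w j i k =
      w (Sum.inr ⟨(i, α k + Finsupp.single j 1), hE, k, hki, j, rfl⟩) := by
  simp only [specMatrix, paramMatrix, Matrix.map_apply, Matrix.of_apply]
  rw [dif_pos hki, dif_neg hE, aeval_X]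

theorem specMatrix_exponent (w : Fin n ⊕ ParamIndex α → R) (j : Fin n) {i k : Fin δ} (hki : k < i)
    (hE : α k + Finsupp.single j 1 ∈ Set.range α) :
    specMatrix K w j i k = if α i = α k + Finsupp.single j 1 then 1 else 0 := by
  simp only [specMatrix, paramMatrix, Matrix.map_apply, Matrix.of_apply]
  rw [dif_pos hki, dif_pos hE]
  split_ifs <;> simp

variable [NeZero δ]

/-- A column whose shifted exponent stays in E contains no parameter, so this holds at every
specialization. -/
theorem specMatrix_mulVec_single (hα : IsConnectedExponents α) (w : Fin n ⊕ ParamIndex α → R)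
    {i : Fin n} {j k : Fin δ} (h : α k = α j + Finsupp.single i 1) :
    (specMatrix K w i).mulVec (Pi.single j 1) = Pi.single k 1 := by
  ext r
  rw [Matrix.mulVec_single_one, Matrix.col_apply, Pi.single_apply]
  by_cases hr : j < r
  · rw [specMatrix_exponent w i hr ⟨k, h⟩, ← h]
    simp only [hα.injective.eq_iff]
  · rw [specMatrix_of_le w i r j (not_lt.mp hr), if_neg]
    rintro rfl
    exact hr (hα.lt_of_eq_add h)

/-- By connectedness, e₀ is a cyclic vector for the matrices, whatever the values of the parameters.
-/
theorem specMatrix_cyclic (hα : IsConnectedExponents α) (w : Fin n ⊕ ParamIndex α → R)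
    {P : (Fin δ → R) → Prop} (h0 : P (Pi.single 0 1))
    (hs : ∀ i v, P v → P ((specMatrix K w i).mulVec v)) (k : Fin δ) : P (Pi.single k 1) :=
  hα.induction h0 (fun _ _ i h hj => specMatrix_mulVec_single (K := K) hα w h ▸ hs i _ hj) k

theorem aeval_paramNormalForm (w : Fin n ⊕ ParamIndex α → R) (p : MvPolynomial (Fin n) K)
    (a : Fin δ) :
    aeval w (paramNormalForm α p a) =
      ((∑ᶠ γ : Fin n →₀ ℕ, (algebraMap K R (multiFactorial γ : K)⁻¹ *
        aeval (fun i => w (Sum.inl i)) (mixedPartial γ p)) •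
          orderedMonomial (specMatrix K w) γ).mulVec (Pi.single 0 1)) a := by
  let g : (Fin δ → ParamRing K α) →+ (Fin δ → R) :=
    ((aeval w : ParamRing K α →ₐ[K] R) : ParamRing K α →+ R).compLeft (Fin δ)
  let m : Matrix (Fin δ) (Fin δ) R →+ (Fin δ → R) :=
    Matrix.mulVec.addMonoidHomLeft (Pi.single 0 1)
  have hg : ∀ v, g v = fun a => aeval w (v a) := fun v => rfl
  have h1 : g (paramNormalForm α p) = (∑ᶠ γ : Fin n →₀ ℕ, (algebraMap K R (multiFactorial γ : K)⁻¹ *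
        aeval (fun i => w (Sum.inl i)) (mixedPartial γ p)) •
          orderedMonomial (specMatrix K w) γ).mulVec (Pi.single 0 1) := by
    rw [paramNormalForm, map_finsum g (support_taylor_subset p (fun γ q =>
        (C ((multiFactorial γ : K)⁻¹) * rename Sum.inl q : ParamRing K α) •
          (orderedMonomial (paramMatrix K α) γ).mulVec (Pi.single 0 1)) (by simp)),
      show ∀ M : Matrix (Fin δ) (Fin δ) R, M.mulVec (Pi.single 0 1) = m M from fun _ => rfl,
      map_finsum m (support_taylor_subset p (fun γ q =>
        (algebraMap K R (multiFactorial γ : K)⁻¹ * aeval (fun i => w (Sum.inl i)) q) •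
          orderedMonomial (specMatrix K w) γ) (by simp))]
    refine finsum_congr fun γ => ?_
    rw [show ∀ M : Matrix (Fin δ) (Fin δ) R, m M = M.mulVec (Pi.single 0 1) from fun _ => rfl,
      hg, Matrix.smul_mulVec]
    have hM : orderedMonomial (specMatrix K w) γ =
        (orderedMonomial (paramMatrix K α) γ).map (aeval w) :=
      (map_orderedMonomial (aeval w : ParamRing K α →ₐ[K] R).mapMatrix (paramMatrix K α) γ).symm
    ext a
    rw [hM, Pi.smul_apply, Pi.smul_apply, smul_eq_mul, smul_eq_mul, map_mul, map_mul,
      Matrix.mulVec_single_one, Matrix.mulVec_single_one, Matrix.col_apply, Matrix.col_apply,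
      Matrix.map_apply, aeval_rename, aeval_C]
    rfl
  exact congrFun h1 a

/-- A specialization with commuting matrices defines a homomorphism which computes the normal
forms. -/
theorem exists_algHom_normalForm [CharZero K] (w : Fin n ⊕ ParamIndex α → R)
    (hw : ∀ i j, specMatrix K w i * specMatrix K w j = specMatrix K w j * specMatrix K w i) :
    ∃ φ : MvPolynomial (Fin n) R →ₐ[R] Matrix (Fin δ) (Fin δ) R,
      (∀ i, φ (X i) = algebraMap R _ (w (Sum.inl i)) + specMatrix K w i) ∧
      ∀ (p : MvPolynomial (Fin n) K) a, aeval w (paramNormalForm α p a) =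
        (φ (map (algebraMap K R) p)).mulVec (Pi.single 0 1) a := by
  obtain ⟨φ, h1, h2⟩ := exists_algHom_taylor (K := K) (fun i => w (Sum.inl i)) (specMatrix K w) hw
  exact ⟨φ, h1, fun p a => by rw [aeval_paramNormalForm, h2]⟩

theorem specMatrix_commute_of_root {N : ℕ} {f : Fin N → MvPolynomial (Fin n) K}
    {w : Fin n ⊕ ParamIndex α → R} (hw : ∀ k, aeval w (deflatedSystem α f k) = 0) (i j : Fin n) :
    specMatrix K w i * specMatrix K w j = specMatrix K w j * specMatrix K w i := by
  ext a b
  have h := hw (Sum.inr ((i, j), (a, b)))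
  simp only [deflatedSystem] at h
  rw [Matrix.sub_apply, map_sub, sub_eq_zero] at h
  have h1 : ∀ i j, specMatrix K w i * specMatrix K w j =
      (paramMatrix K α i * paramMatrix K α j).map (aeval w) := fun i j =>
    (map_mul (aeval w : ParamRing K α →ₐ[K] R).mapMatrix _ _).symm
  rw [h1, h1]
  exact h

/-- Row 0 of a strictly lower triangular matrix is zero, so on coordinate 0 each x_i acts as the
scalar z_i. Consequently entry 0 of the normal form of p is p(z). -/
theorem algHom_mulVec_apply_zero {w : Fin n ⊕ ParamIndex α → R}
    {φ : MvPolynomial (Fin n) R →ₐ[R] Matrix (Fin δ) (Fin δ) R}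
    (hφ : ∀ i, φ (X i) = algebraMap R _ (w (Sum.inl i)) + specMatrix K w i)
    (p : MvPolynomial (Fin n) R) (v : Fin δ → R) :
    (φ p).mulVec v 0 = eval (fun i => w (Sum.inl i)) p * v 0 := by
  induction p using MvPolynomial.induction_on generalizing v with
  | C a =>
    rw [← algebraMap_eq, AlgHom.commutes, Algebra.algebraMap_eq_smul_one, Matrix.smul_mulVec,
      Matrix.one_mulVec, algebraMap_eq, eval_C]
    rfl
  | add p q hp hq => rw [map_add, Matrix.add_mulVec, Pi.add_apply, hp, hq, map_add, add_mul]
  | mul_X p i hp =>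
    have h0 : (specMatrix K w i).mulVec v 0 = 0 := by
      rw [Matrix.mulVec, dotProduct]
      exact Finset.sum_eq_zero fun k _ => by
        rw [specMatrix_of_le w i 0 k (Fin.zero_le k), zero_mul]
    rw [map_mul, ← Matrix.mulVec_mulVec, hp, hφ, Matrix.add_mulVec, Pi.add_apply, h0, add_zero,
      Algebra.algebraMap_eq_smul_one, Matrix.smul_mulVec, Matrix.one_mulVec, map_mul, eval_X,
      Pi.smul_apply, smul_eq_mul, mul_assoc]

/-- Every root of the deflated system lies above a root of the original system. -/
theorem aeval_inl_eq_zero_of_root [CharZero K] {N : ℕ} {f : Fin N → MvPolynomial (Fin n) K}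
    {w : Fin n ⊕ ParamIndex α → R} (hw : ∀ k, aeval w (deflatedSystem α f k) = 0) (k : Fin N) :
    aeval (fun i => w (Sum.inl i)) (f k) = 0 := by
  obtain ⟨φ, h1, h2⟩ := exists_algHom_normalForm w (specMatrix_commute_of_root hw)
  have h := (h2 (f k) 0).symm.trans (hw (Sum.inl (k, 0)))
  rwa [algHom_mulVec_apply_zero h1, eval_map, ← aeval_def, Pi.single_eq_same, mul_one] at h

end Specialization

/-! ### Multiplication in the local ring -/

theorem shiftedMonomial_zero {n : ℕ} (ξ : Fin n → ℂ) : shiftedMonomial ξ 0 = 1 := by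
  simp [shiftedMonomial]

theorem shiftedMonomial_add_single {n : ℕ} (ξ : Fin n → ℂ) (γ : Fin n →₀ ℕ) (j : Fin n) :
    shiftedMonomial ξ (γ + Finsupp.single j 1) = (X j - C (ξ j)) * shiftedMonomial ξ γ := by
  simp only [shiftedMonomial, Finsupp.add_apply, pow_add, Finset.prod_mul_distrib]
  rw [mul_comm, Finset.prod_eq_single j]
  · simp
  · intro i _ hi
    simp [hi.symm]
  · simp

/-- The coordinates of a polynomial in the primal basis. -/
def dualVec {n δ : ℕ} (ξ : Fin n → ℂ) (Λ : Fin δ → MvPolynomial (Fin n) ℂ) :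
    MvPolynomial (Fin n) ℂ →ₗ[ℂ] (Fin δ → ℂ) :=
  LinearMap.pi fun i => applyAtLinear ξ (Λ i)

theorem dualVec_apply {n δ : ℕ} (ξ : Fin n → ℂ) (Λ : Fin δ → MvPolynomial (Fin n) ℂ)
    (p : MvPolynomial (Fin n) ℂ) (i : Fin δ) : dualVec ξ Λ p i = applyAt ξ (Λ i) p := rfl

/-- The matrix of the multiplication by `x_j - ξ_j` in the primal basis. -/
def mulMatrix {n δ : ℕ} (ξ : Fin n → ℂ) (α : Fin δ → Fin n →₀ ℕ)
    (Λ : Fin δ → MvPolynomial (Fin n) ℂ) (j : Fin n) : Matrix (Fin δ) (Fin δ) ℂ :=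
  Matrix.of fun i k => dualVec ξ Λ ((X j - C (ξ j)) * shiftedMonomial ξ (α k)) i

namespace IsOrthogonalPrimalDualPair

variable {n δ : ℕ} [NeZero δ] {I : Ideal (MvPolynomial (Fin n) ℂ)} {ξ : Fin n → ℂ}
  {α : Fin δ → Fin n →₀ ℕ} {Λ : Fin δ → MvPolynomial (Fin n) ℂ}

theorem exponent_injective (h : IsOrthogonalPrimalDualPair I ξ α Λ) : Function.Injective α :=
  fun _ _ hij => h.primal_linearIndependent.injective (by simp only [hij])

/-- Turns the ordering of the Λ_i by order into the ordering of the α_i by degree. -/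
theorem totalDegree_dual (h : IsOrthogonalPrimalDualPair I ξ α Λ) (i : Fin δ) :
    (Λ i).totalDegree = (α i).degree := by
  have hdeg : ∀ β : Fin n →₀ ℕ, (β.sum fun _ e => e) = β.degree := fun β => by
    rw [Finsupp.degree_eq_sum, Finsupp.sum_fintype _ _ (by simp)]
  refine le_antisymm (Finset.sup_le fun β hβ => ?_) ?_
  · rw [hdeg]
    by_cases hβi : β = α i
    · rw [hβi]
    · exact (h.dual_coeff_other i β (mem_support_iff.mp hβ) hβi).1
  · rw [← hdeg]
    refine le_totalDegree (mem_support_iff.mpr ?_)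
    rw [h.dual_coeff_self]
    exact inv_ne_zero (multiFactorial_ne_zero _)

theorem isConnectedExponents (h : IsOrthogonalPrimalDualPair I ξ α Λ) :
    IsConnectedExponents α where
  injective := h.exponent_injective
  zero := h.exponent_zero
  connected := h.connected
  monotone := by simpa only [← h.totalDegree_dual] using h.order_monotone

theorem dualVec_eq_zero (h : IsOrthogonalPrimalDualPair I ξ α Λ) {q : MvPolynomial (Fin n) ℂ}
    (hq : q ∈ primaryComponentAt I ξ) : dualVec ξ Λ q = 0 := by
  ext i
  refine applyAt_eq_zero_of_mem_primaryComponentAt ?_ hq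
  rw [← h.dual_span]
  exact Submodule.subset_span ⟨i, rfl⟩

theorem dualVec_shiftedMonomial (h : IsOrthogonalPrimalDualPair I ξ α Λ) (k : Fin δ) :
    dualVec ξ Λ (shiftedMonomial ξ (α k)) = Pi.single k 1 := by
  ext i
  rw [dualVec_apply, h.orthogonal, Pi.single_apply]

theorem dualVec_one (h : IsOrthogonalPrimalDualPair I ξ α Λ) :
    dualVec ξ Λ 1 = Pi.single 0 1 := by
  rw [← h.dualVec_shiftedMonomial, h.exponent_zero, shiftedMonomial_zero]

/-- Expand p in the primal basis modulo Q; since the Λ_i vanish on Q, orthogonality identifies the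
coefficients with the values of the Λ_i at p. -/
theorem sub_sum_mem (h : IsOrthogonalPrimalDualPair I ξ α Λ) (p : MvPolynomial (Fin n) ℂ) :
    p - ∑ k, dualVec ξ Λ p k • shiftedMonomial ξ (α k) ∈ primaryComponentAt I ξ := by
  have hp : Ideal.Quotient.mk (primaryComponentAt I ξ) p ∈ Submodule.span ℂ (Set.range fun i =>
      Ideal.Quotient.mk (primaryComponentAt I ξ) (shiftedMonomial ξ (α i))) := by
    rw [h.primal_span]
    trivial
  obtain ⟨c, hc⟩ := (Submodule.mem_span_range_iff_exists_fun ℂ).mp hp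
  have hmem : p - ∑ k, c k • shiftedMonomial ξ (α k) ∈ primaryComponentAt I ξ := by
    rw [← Ideal.Quotient.eq, ← hc, ← Ideal.Quotient.mkₐ_eq_mk ℂ, map_sum]
    simp only [map_smul]
  have hcp : dualVec ξ Λ p = c := by
    have h0 := h.dualVec_eq_zero hmem
    rw [map_sub, sub_eq_zero] at h0
    rw [h0, map_sum]
    ext i
    simp [h.dualVec_shiftedMonomial, Pi.single_apply]
  rwa [hcp]

theorem dualVec_mul (h : IsOrthogonalPrimalDualPair I ξ α Λ) (j : Fin n)
    (p : MvPolynomial (Fin n) ℂ) :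
    dualVec ξ Λ ((X j - C (ξ j)) * p) = (mulMatrix ξ α Λ j).mulVec (dualVec ξ Λ p) := by
  have h0 := h.dualVec_eq_zero
    ((primaryComponentAt I ξ).mul_mem_left (X j - C (ξ j)) (h.sub_sum_mem p))
  rw [mul_sub, map_sub, sub_eq_zero] at h0
  rw [h0, Finset.mul_sum, map_sum]
  ext i
  simp only [mul_smul_comm, map_smul, Finset.sum_apply, Pi.smul_apply, smul_eq_mul, mulMatrix,
    Matrix.mulVec, dotProduct, Matrix.of_apply]
  exact Finset.sum_congr rfl fun k _ => mul_comm _ _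

/-- Both products represent multiplication by (x_i - ξ_i)(x_j - ξ_j). -/
theorem mulMatrix_commute (h : IsOrthogonalPrimalDualPair I ξ α Λ) (i j : Fin n) :
    mulMatrix ξ α Λ i * mulMatrix ξ α Λ j = mulMatrix ξ α Λ j * mulMatrix ξ α Λ i := by
  refine Matrix.ext_of_mulVec_single fun k => ?_
  rw [← h.dualVec_shiftedMonomial, ← Matrix.mulVec_mulVec, ← Matrix.mulVec_mulVec, ← h.dualVec_mul,
    ← h.dualVec_mul, ← h.dualVec_mul, ← h.dualVec_mul, mul_left_comm]

/-- Entry (i, k) of the multiplication matrix is Λ_i((x - ξ)^{α_k + e_j}) = ν_{α_i, α_k + e_j}. The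
prescribed form of Λ_i gives the 0/1 pattern on E and strict triangularity. -/
theorem specMatrix_deflatedPoint {K : Type*} [Field K] [Algebra K ℂ]
    (h : IsOrthogonalPrimalDualPair I ξ α Λ) (j : Fin n) :
    specMatrix K (deflatedPoint ξ α Λ) j = mulMatrix ξ α Λ j := by
  ext i k
  have hentry : mulMatrix ξ α Λ j i k = dualCoeff Λ i (α k + Finsupp.single j 1) := by
    rw [mulMatrix, Matrix.of_apply, dualVec_apply, ← shiftedMonomial_add_single,
      applyAt_shiftedMonomial, dualCoeff]
  rw [hentry]
  by_cases hki : k < i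
  · by_cases hE : α k + Finsupp.single j 1 ∈ Set.range α
    · rw [specMatrix_exponent _ j hki hE]
      split_ifs with hi
      · rw [← hi, dualCoeff, h.dual_coeff_self, mul_inv_cancel₀ (multiFactorial_ne_zero _)]
      · rw [dualCoeff, eq_comm, mul_eq_zero]
        right
        by_contra hc
        exact (h.dual_coeff_other i _ hc (Ne.symm hi)).2 hE
    · rw [specMatrix_param _ j hki hE]
      rfl
  · rw [specMatrix_of_le _ j i k (not_lt.mp hki), dualCoeff, eq_comm, mul_eq_zero]
    right
    by_contra hc
    -- For i ≤ k the exponent α_k + e_j has degree greater than |α_i|, so it cannot occur in Λ_i.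
    have hdeg := h.isConnectedExponents.monotone (not_lt.mp hki)
    have hle : (α k + Finsupp.single j 1).degree ≤ (α i).degree := by
      by_cases hi : α k + Finsupp.single j 1 = α i
      · rw [hi]
      · exact (h.dual_coeff_other i _ hc hi).1
    simp only [map_add, Finsupp.degree_single] at hle hdeg
    omega

/-- At (ξ, ν) the normal form of p is its coordinate vector in ℂ[x]/Q, which is zero for p ∈ I. -/
theorem aeval_deflatedSystem {K : Type*} [Field K] [CharZero K] [Algebra K ℂ] {N : ℕ}
    {f : Fin N → MvPolynomial (Fin n) K} (h : IsOrthogonalPrimalDualPair (systemIdeal f) ξ α Λ)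
    (k) : aeval (deflatedPoint ξ α Λ) (deflatedSystem α f k) = 0 := by
  have hcomm : ∀ i j, specMatrix K (deflatedPoint ξ α Λ) i * specMatrix K (deflatedPoint ξ α Λ) j =
      specMatrix K (deflatedPoint ξ α Λ) j * specMatrix K (deflatedPoint ξ α Λ) i := fun i j => by
    rw [h.specMatrix_deflatedPoint, h.specMatrix_deflatedPoint, h.mulMatrix_commute]
  obtain ⟨φ, hφ, hnf⟩ := exists_algHom_normalForm (deflatedPoint ξ α Λ) hcomm
  have hdual : ∀ p : MvPolynomial (Fin n) ℂ, (φ p).mulVec (Pi.single 0 1) = dualVec ξ Λ p := by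
    intro p
    induction p using MvPolynomial.induction_on with
    | C a =>
      rw [← algebraMap_eq, AlgHom.commutes, Algebra.algebraMap_eq_smul_one,
        Algebra.algebraMap_eq_smul_one, map_smul, h.dualVec_one, Matrix.smul_mulVec,
        Matrix.one_mulVec]
    | add p q hp hq => rw [map_add, Matrix.add_mulVec, hp, hq, map_add]
    | mul_X p i hp =>
      have hX : p * X i = ξ i • p + (X i - C (ξ i)) * p := by
        rw [smul_eq_C_mul]
        ring
      rw [hX, map_add (dualVec ξ Λ), h.dualVec_mul, ← hX, mul_comm, map_mul, ← Matrix.mulVec_mulVec, hp, hφ,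
        h.specMatrix_deflatedPoint, Matrix.add_mulVec, Algebra.algebraMap_eq_smul_one,
        Matrix.smul_mulVec, Matrix.one_mulVec, map_smul]
      rfl
  rcases k with ⟨k, a⟩ | ⟨⟨i, j⟩, a, b⟩
  · simp only [deflatedSystem]
    rw [hnf, hdual, h.dualVec_eq_zero (le_primaryComponentAt _ _ (Ideal.subset_span ⟨k, rfl⟩))]
    rfl
  · have hmul : ∀ i j, specMatrix K (deflatedPoint ξ α Λ) i * specMatrix K (deflatedPoint ξ α Λ) j =
        (paramMatrix K α i * paramMatrix K α j).map (aeval (deflatedPoint ξ α Λ)) := fun i j =>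
      (map_mul (aeval (deflatedPoint ξ α Λ) : ParamRing K α →ₐ[K] ℂ).mapMatrix _ _).symm
    have := congrFun (congrFun (hcomm i j) a) b
    rw [hmul, hmul] at this
    simp only [deflatedSystem]
    rw [Matrix.sub_apply, map_sub, sub_eq_zero]
    exact this

/-- A point of the deflated system with values in a `ℂ`-algebra, whose `z`-coordinates differ from
`ξ` by nilpotent elements, is the point `(ξ, ν)`. -/
theorem eq_deflatedPoint {K R : Type*} [Field K] [CharZero K] [Algebra K ℂ] [CommRing R]
    [Algebra ℂ R] [Algebra K R] [IsScalarTower K ℂ R] {N : ℕ}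
    {f : Fin N → MvPolynomial (Fin n) K} (h : IsOrthogonalPrimalDualPair (systemIdeal f) ξ α Λ)
    {w : Fin n ⊕ ParamIndex α → R} (hw : ∀ k, aeval w (deflatedSystem α f k) = 0)
    (hz : ∀ j, IsNilpotent (w (Sum.inl j) - algebraMap ℂ R (ξ j))) :
    w = fun s => algebraMap ℂ R (deflatedPoint ξ α Λ s) := by
  have hα := h.isConnectedExponents
  have hcomm := specMatrix_commute_of_root hw
  obtain ⟨φ, hφ, hnf⟩ := exists_algHom_normalForm w hcomm
  let ψ : MvPolynomial (Fin n) ℂ →+* Matrix (Fin δ) (Fin δ) R :=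
    (φ : MvPolynomial (Fin n) R →+* _).comp (map (algebraMap ℂ R))
  let c : Fin n → R := fun j => w (Sum.inl j) - algebraMap ℂ R (ξ j)
  have hψC : ∀ a, ψ (C a) = algebraMap R _ (algebraMap ℂ R a) := fun a => by
    simp only [ψ, RingHom.comp_apply, map_C]
    exact φ.commutes _
  have hψX : ∀ j, ψ (X j - C (ξ j)) = algebraMap R _ (c j) + specMatrix K w j := fun j => by
    rw [map_sub, hψC]
    simp only [ψ, RingHom.comp_apply, map_X, RingHom.coe_coe, hφ, c, map_sub]
    abel
  -- The homomorphism vanishes on the local component.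
  have hker : primaryComponentAt (systemIdeal f) ξ ≤ RingHom.ker ψ := by
    refine primaryComponentAt_le ?_ ?_
    · rw [systemIdeal, Ideal.span_le]
      rintro _ ⟨k, rfl⟩
      refine Matrix.ext_of_mulVec_single fun i => ?_
      rw [Matrix.zero_mulVec]
      have hmap : ψ (map (algebraMap K ℂ) (f k)) = φ (map (algebraMap K R) (f k)) := by
        simp only [ψ, RingHom.comp_apply, map_map, ← IsScalarTower.algebraMap_eq]
        rfl
      rw [hmap]
      refine specMatrix_cyclic (K := K) hα w
        (P := fun v => (φ (map (algebraMap K R) (f k))).mulVec v = 0) ?_ (fun j v hv => ?_) i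
      · ext a
        rw [← hnf]
        exact hw (Sum.inl (k, a))
      -- The matrix lies in the image of φ, hence commutes with φ(f_k), and the vectors killed by
      -- φ(f_k) are stable under it.
      · have hM : specMatrix K w j = φ (X j - C (w (Sum.inl j))) := by
          rw [map_sub, hφ, ← algebraMap_eq, AlgHom.commutes, add_sub_cancel_left]
        rw [hM, Matrix.mulVec_mulVec, ← map_mul, mul_comm, map_mul, ← Matrix.mulVec_mulVec, hv,
          Matrix.mulVec_zero]
    · rw [pointIdeal, Ideal.span_le]
      rintro _ ⟨j, rfl⟩
      have hnil : IsNilpotent (ψ (X j - C (ξ j))) := by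
        rw [hψX]
        exact Commute.isNilpotent_add (Algebra.commutes _ _)
          ((hz j).map (algebraMap R (Matrix (Fin δ) (Fin δ) R))) (isNilpotent_specMatrix w j)
      obtain ⟨m, hm⟩ := hnil
      exact ⟨m, by rw [RingHom.mem_ker, map_pow, hm]⟩
  -- The matrix of the comparison map from the local ring.
  let P : Matrix (Fin δ) (Fin δ) R :=
    Matrix.of fun i k => (ψ (shiftedMonomial ξ (α k))).mulVec (Pi.single 0 1) i
  have hPk : ∀ k, P.mulVec (Pi.single k 1) =
      (ψ (shiftedMonomial ξ (α k))).mulVec (Pi.single 0 1) := fun k => by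
    rw [Matrix.mulVec_single_one]
    rfl
  have hP : ∀ q, (ψ q).mulVec (Pi.single 0 1) =
      P.mulVec fun k => algebraMap ℂ R (dualVec ξ Λ q k) := fun q => by
    have hq := hker (h.sub_sum_mem q)
    rw [RingHom.mem_ker, map_sub, sub_eq_zero] at hq
    rw [hq, map_sum, Matrix.sum_mulVec]
    ext i
    rw [Finset.sum_apply, Matrix.mulVec, dotProduct]
    refine Finset.sum_congr rfl fun k _ => ?_
    rw [smul_eq_C_mul, map_mul, hψC, ← Matrix.mulVec_mulVec, Algebra.algebraMap_eq_smul_one,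
      Matrix.smul_mulVec, Matrix.one_mulVec, Pi.smul_apply, smul_eq_mul, mul_comm]
    rfl
  let T : Fin n → Matrix (Fin δ) (Fin δ) R := fun j => (mulMatrix ξ α Λ j).map (algebraMap ℂ R)
  -- Both sides send e_k to `ψ` of (x_j - ξ_j)(x - ξ)^{α_k}, applied to e₀.
  have hPT : ∀ j, (algebraMap R _ (c j) + specMatrix K w j) * P = P * T j := fun j => by
    refine Matrix.ext_of_mulVec_single fun k => ?_
    rw [← Matrix.mulVec_mulVec, hPk, ← hψX, Matrix.mulVec_mulVec, ← map_mul, hP,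
      ← Matrix.mulVec_mulVec, Matrix.mulVec_single_one]
    rfl
  have hsurj : ∀ k, ∃ v, P.mulVec v = Pi.single k 1 := by
    refine specMatrix_cyclic (K := K) hα w (P := fun y => ∃ v, P.mulVec v = y)
      ⟨fun k => algebraMap ℂ R (dualVec ξ Λ 1 k), by rw [← hP, map_one, Matrix.one_mulVec]⟩ ?_
    rintro j _ ⟨v, rfl⟩
    -- The intertwining relation gives M_j P v = P(T_j v) - c_j P v, so the image of P is stable
    -- under M_j.
    refine ⟨(T j).mulVec v - c j • v, ?_⟩
    rw [Matrix.mulVec_sub, Matrix.mulVec_mulVec, ← hPT, Matrix.mulVec_smul, ← Matrix.mulVec_mulVec,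
      Matrix.add_mulVec, Algebra.algebraMap_eq_smul_one, Matrix.smul_mulVec, Matrix.one_mulVec,
      add_sub_cancel_left]
  choose V hV using hsurj
  have hPV : P * (Matrix.of V).transpose = 1 := by
    refine Matrix.ext_of_mulVec_single fun k => ?_
    rw [← Matrix.mulVec_mulVec, Matrix.mulVec_single_one, Matrix.one_mulVec]
    exact hV k
  -- A one-sided inverse of a square matrix over a commutative ring is two-sided.
  have hVP := mul_eq_one_comm.mp hPV
  have htrT : ∀ j, (T j).trace = 0 := fun j => by
    have h0 := trace_specMatrix (K := K) (deflatedPoint ξ α Λ) j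
    rw [h.specMatrix_deflatedPoint] at h0
    rw [← map_zero (algebraMap ℂ R), ← h0]
    exact (AddMonoidHom.map_trace (algebraMap ℂ R) _).symm
  -- Conjugate matrices have equal traces, so δ c_j = 0, and δ is invertible in a ℂ-algebra.
  have hc : ∀ j, c j = 0 := fun j => by
    have htr : (algebraMap R (Matrix (Fin δ) (Fin δ) R) (c j) + specMatrix K w j).trace = 0 := by
      rw [← mul_one (_ + _), ← hPV, ← mul_assoc, hPT, Matrix.trace_mul_comm, ← mul_assoc, hVP,
        one_mul, htrT]
    rw [Matrix.trace_add, trace_specMatrix, add_zero, Algebra.algebraMap_eq_smul_one,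
      Matrix.trace_smul, Matrix.trace_one, Fintype.card_fin, smul_eq_mul] at htr
    have hδ : (δ : R) * algebraMap ℂ R (δ : ℂ)⁻¹ = 1 := by
      rw [← map_natCast (algebraMap ℂ R), ← map_mul,
        mul_inv_cancel₀ (Nat.cast_ne_zero.mpr (NeZero.ne δ)), map_one]
    rw [← mul_one (c j), ← hδ, ← mul_assoc, htr, zero_mul]
  have hP1 : P = 1 := by
    refine Matrix.ext_of_mulVec_single fun k => ?_
    rw [hPk, Matrix.one_mulVec]
    refine hα.induction (P := fun k => (ψ (shiftedMonomial ξ (α k))).mulVec (Pi.single 0 1) =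
      Pi.single k 1) ?_ ?_ k
    · rw [hα.zero, shiftedMonomial_zero, map_one, Matrix.one_mulVec]
    · intro j k i hk hj
      rw [hk, shiftedMonomial_add_single, map_mul, ← Matrix.mulVec_mulVec, hj, hψX, hc, map_zero,
        zero_add, specMatrix_mulVec_single hα w hk]
  have hMT : ∀ j, specMatrix K w j = T j := fun j => by
    have := hPT j
    rwa [hP1, mul_one, one_mul, hc, map_zero, zero_add] at this
  ext s
  rcases s with j | ⟨⟨i, β⟩, hβ, k, hki, j, hj⟩
  · exact sub_eq_zero.mp (hc j)
  · dsimp only at hβ hki hj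
    subst hj
    -- Every parameter occurs as an entry of some M_j, so equality of the matrices determines it.
    rw [← specMatrix_param (K := K) w j hki hβ, hMT,
      ← specMatrix_param (K := K) (deflatedPoint ξ α Λ) j hki hβ, h.specMatrix_deflatedPoint]
    rfl

end IsOrthogonalPrimalDualPair

end

/-! ### Isolatedness and multiplicity one from rigidity -/

theorem theorem2 (K : Subfield ℂ) {n N δ : ℕ} [NeZero δ]
    (f : Fin N → MvPolynomial (Fin n) K) (ξ : Fin n → ℂ) (hξ : IsIsolatedRoot f ξ)
    (α : Fin δ → Fin n →₀ ℕ) (Λ : Fin δ → MvPolynomial (Fin n) ℂ)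
    (hB : IsOrthogonalPrimalDualPair (systemIdeal f) ξ α Λ) :
    IsIsolatedRoot (deflatedSystem α f) (deflatedPoint ξ α Λ) ∧
      multiplicityAt (systemIdeal (deflatedSystem α f)) (deflatedPoint ξ α Λ) = 1 := by
  refine ⟨⟨hB.aeval_deflatedSystem, ?_⟩, multiplicityAt_eq_one ?_ ?_⟩
  · have hcont : Filter.Tendsto (fun y : Fin n ⊕ ParamIndex α → ℂ => fun i => y (Sum.inl i))
        (nhds (deflatedPoint ξ α Λ)) (nhds ξ) :=
      Continuous.tendsto (by fun_prop) (deflatedPoint ξ α Λ)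
    filter_upwards [hcont.eventually hξ.2] with y hy hroot
    -- The z-part of a nearby root is a root of f near ξ, hence equals ξ; the nilpotent differences
    -- are then zero.
    have hyξ := hy (aeval_inl_eq_zero_of_root hroot)
    refine hB.eq_deflatedPoint hroot fun j => ?_
    rw [← hyξ]
    simp
  · rw [systemIdeal, Ideal.span_le]
    rintro _ ⟨k, rfl⟩
    rw [SetLike.mem_coe, mem_pointIdeal_iff, eval_map, ← aeval_def]
    exact hB.aeval_deflatedSystem k
  · set x := deflatedPoint ξ α Λ with hx
    set J := systemIdeal (deflatedSystem α f) ⊔ pointIdeal x * pointIdeal x with hJ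
    -- The tautological point modulo `J`: it solves the deflated system, and its differences from x
    -- have square zero. Rigidity makes the coordinates constant modulo `J`, which is the required
    -- cotangent inclusion.
    let w : Fin n ⊕ ParamIndex α → MvPolynomial (Fin n ⊕ ParamIndex α) ℂ ⧸ J :=
      fun s => Ideal.Quotient.mk J (X s)
    have hw : ∀ p : ParamRing K α,
        aeval w p = Ideal.Quotient.mk J (map (algebraMap K ℂ) p) := fun p => by
      induction p using MvPolynomial.induction_on with
      | C a =>
        rw [aeval_C, map_C]
        rfl
      | add p q hp hq => rw [map_add, hp, hq, map_add, map_add]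
      | mul_X p i hp => rw [map_mul, hp, aeval_X, map_mul, map_mul, map_X]
    have hpt := hB.eq_deflatedPoint (w := w) (fun k => ?_) (fun j => ⟨2, ?_⟩)
    · rw [pointIdeal, Ideal.span_le]
      rintro _ ⟨s, rfl⟩
      rw [SetLike.mem_coe, ← Ideal.Quotient.eq]
      exact congrFun hpt s
    · rw [hw, Ideal.Quotient.eq_zero_iff_mem]
      exact Ideal.mem_sup_left (Ideal.subset_span ⟨k, rfl⟩)
    · have hmem : (X (Sum.inl j) - C (x (Sum.inl j))) ^ 2 ∈ J := by
        rw [pow_two]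
        exact Ideal.mem_sup_right
          (Ideal.mul_mem_mul (X_sub_C_mem_pointIdeal x _) (X_sub_C_mem_pointIdeal x _))
      have h0 := Ideal.Quotient.eq_zero_iff_mem.mpr hmem
      rw [map_pow, map_sub] at h0
      exact h0
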